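/- Let $n \ge 1$ and let $(\bar g_{ij}(r))_{i,j=2,\dots,n}$ be a symmetric, positive-definite matrix of smooth functions $\bar g_{ij}\colon\mathbb{R}\to\mathbb{R}$. Let $\mathscr{F}_{\bar g}$ denote the set of all (smooth) Riemannian metrics $g_R$ on $\mathbb{R}^{n} = \{(r,x^2,\dots,x^n)\}$ of the form $$g_R = (dr)^2 + \sum_{i,j=2}^n g_{ij}(r,x^2,\dots,x^n)\,dx^i dx^j, \qquad g_{ij}(r,0,\dots,0) = \bar g_{ij}(r) \ \text{ for all } r\in\mathbb{R}.$$ On $\mathbb{R}^{n+1} = \{(r,t,x^2,\dots,x^n)\}$ let $h_{PW}$ be the Lorentzian plane wave metric $$h_{PW} = 2\,dr\,dt + \sum_{i,j=2}^n \bar g_{ij}(r)\,dx^i dx^j.$$ Call a metric Ricci-flat if $\mathrm{Ric}=0$ everywhere, locally symmetric if $\nabla \mathrm{Rm}=0$ everywhere, and say that it has parallel Ricci tensor if $\nabla\mathrm{Ric}=0$ everywhere, where $\nabla$, $\mathrm{Rm}$, $\mathrm{Ric}$ are its Levi-Civita connection, curvature 4-tensor and Ricci tensor. Then: 1. If $h_{PW}$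 is not Ricci-flat, then no $g_R\in\mathscr{F}_{\bar g}$ is Ricci-flat. 2. If $h_{PW}$ is not locally symmetric, then no $g_R\in\mathscr{F}_{\bar g}$ is locally symmetric. 3. If $h_{PW}$ does not have parallel Ricci tensor, then no $g_R\in\mathscr{F}_{\bar g}$ has parallel Ricci tensor. -/

import Mathlib

open scoped ContDiff

/-! Semi-Riemannian geometry of a metric on `ℝ^κ`, in the global coordinates indexed by a finite
type `κ`.  A metric is given by its matrix of components `g x i j = g(∂_i, ∂_j)` at `x`. -/

noncomputable section

namespace CoordMetric

variable {κ : Type} [Fintype κ] [DecidableEq κ]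

/-- The partial derivative `∂_i f` at `x`. -/
def pd (i : κ) (f : (κ → ℝ) → ℝ) (x : κ → ℝ) : ℝ :=
  fderiv ℝ f x (Pi.single i 1)

/-- The Christoffel symbol `Γ^k_{ij}` of the Levi-Civita connection of `g`, that is
`∇_{∂_i} ∂_j = ∑ k, Γ^k_{ij} ∂_k`. -/
def christoffel (g : (κ → ℝ) → Matrix κ κ ℝ) (k i j : κ) (x : κ → ℝ) : ℝ :=
  (1 / 2 : ℝ) * ∑ l, (g x)⁻¹ k l *
    (pd i (fun y => g y j l) x + pd j (fun y => g y i l) x - pd l (fun y => g y i j) x)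

/-- The component `R^l_{ijk}` of the curvature endomorphism,
`R(∂_i, ∂_j) ∂_k = ∇_{∂_i} ∇_{∂_j} ∂_k - ∇_{∂_j} ∇_{∂_i} ∂_k = ∑ l, R^l_{ijk} ∂_l`. -/
def curvature (g : (κ → ℝ) → Matrix κ κ ℝ) (l i j k : κ) (x : κ → ℝ) : ℝ :=
  pd i (christoffel g l j k) x - pd j (christoffel g l i k) x
    + ∑ p, (christoffel g l i p x * christoffel g p j k x
      - christoffel g l j p x * christoffel g p i k x)

/-- The curvature 4-tensor `Rm(∂_i, ∂_j, ∂_k, ∂_l) = g(R(∂_i, ∂_j) ∂_k, ∂_l)`. -/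
def riemann (g : (κ → ℝ) → Matrix κ κ ℝ) (i j k l : κ) (x : κ → ℝ) : ℝ :=
  ∑ p, g x p l * curvature g p i j k x

/-- The Ricci tensor `Ric(∂_j, ∂_k)`, the trace of `X ↦ R(X, ∂_j) ∂_k`. -/
def ricci (g : (κ → ℝ) → Matrix κ κ ℝ) (j k : κ) (x : κ → ℝ) : ℝ :=
  ∑ i, curvature g i i j k x

/-- The covariant derivative `(∇_{∂_a} Rm)(∂_i, ∂_j, ∂_k, ∂_l)`. -/
def covDerivRiemann (g : (κ → ℝ) → Matrix κ κ ℝ) (a i j k l : κ) (x : κ → ℝ) : ℝ :=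
  pd a (riemann g i j k l) x
    - ∑ p, christoffel g p a i x * riemann g p j k l x
    - ∑ p, christoffel g p a j x * riemann g i p k l x
    - ∑ p, christoffel g p a k x * riemann g i j p l x
    - ∑ p, christoffel g p a l x * riemann g i j k p x

/-- The covariant derivative `(∇_{∂_a} Ric)(∂_i, ∂_j)`. -/
def covDerivRicci (g : (κ → ℝ) → Matrix κ κ ℝ) (a i j : κ) (x : κ → ℝ) : ℝ :=
  pd a (ricci g i j) x
    - ∑ p, christoffel g p a i x * ricci g p j x
    - ∑ p, christoffel g p a j x * ricci g i p x

/-- `Ric = 0` everywhere. -/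
def RicciFlat (g : (κ → ℝ) → Matrix κ κ ℝ) : Prop :=
  ∀ x i j, ricci g i j x = 0

/-- `∇ Rm = 0` everywhere. -/
def LocallySymmetric (g : (κ → ℝ) → Matrix κ κ ℝ) : Prop :=
  ∀ x a i j k l, covDerivRiemann g a i j k l x = 0

/-- `∇ Ric = 0` everywhere. -/
def ParallelRicci (g : (κ → ℝ) → Matrix κ κ ℝ) : Prop :=
  ∀ x a i j, covDerivRicci g a i j x = 0

/-- `g` is a smooth Riemannian metric on `ℝ^κ` (symmetry is part of `Matrix.PosDef`). -/
structure IsRiemannian (g : (κ → ℝ) → Matrix κ κ ℝ) : Prop where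
  smooth : ∀ i j, ContDiff ℝ ∞ (fun x => g x i j)
  posDef : ∀ x, (g x).PosDef

end CoordMetric

/-- The set of Riemannian extensions of `gbar`: all Riemannian metrics
`(dr)² + ∑ g_{ij}(r, x) dx^i dx^j` on `ℝ^{1+m}` with `g_{ij}(r, 0) = gbar_{ij}(r)`.
The coordinate `r` has index `Sum.inl 0`, the `m` coordinates `x` have indices `Sum.inr i`. -/
def riemannianExtensions {m : ℕ} (gbar : ℝ → Matrix (Fin m) (Fin m) ℝ) :
    Set ((Fin 1 ⊕ Fin m → ℝ) → Matrix (Fin 1 ⊕ Fin m) (Fin 1 ⊕ Fin m) ℝ) :=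
  {gR | CoordMetric.IsRiemannian gR ∧
    ∃ g : (Fin 1 ⊕ Fin m → ℝ) → Matrix (Fin m) (Fin m) ℝ,
      (∀ x, gR x = Matrix.fromBlocks 1 0 0 (g x)) ∧
      ∀ r : ℝ, g (Sum.elim (fun _ => r) (fun _ => 0)) = gbar r}

/-- The plane wave `2 dr dt + ∑ gbar_{ij}(r) dx^i dx^j` on `ℝ^{2+m}`.  The coordinates `r`, `t`
have indices `Sum.inl 0`, `Sum.inl 1`; the `m` coordinates `x` have indices `Sum.inr i`. -/
def planeWave {m : ℕ} (gbar : ℝ → Matrix (Fin m) (Fin m) ℝ) :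
    (Fin 2 ⊕ Fin m → ℝ) → Matrix (Fin 2 ⊕ Fin m) (Fin 2 ⊕ Fin m) ℝ :=
  fun x => Matrix.fromBlocks !![0, 1; 1, 0] 0 0 (gbar (x (Sum.inl 0)))

end

/-! Both kinds of metric are governed by one operator built from `gbar` alone. In a metric whose
components `g_{rj}` are constant, the `r`-lines are geodesics, and `∇_{∂_r}` acts on coordinate
fields by the shape operator `S = ½ γ⁻¹ γ'` of the curve `γ` of components along such a line. By
the Riccati equation the Jacobi operator `J = R(·, ∂_r) ∂_r` is `-(S' + S²)`, so that the
components `Rm(·, ∂_r, ∂_r, ·)`, `Ric(∂_r, ∂_r)` and their covariant derivatives along `∂_r`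
depend on `γ` only, and through `γ = dr² ⊕ gbar` on `gbar` only.

In the plane wave there are no other components: the field `∂_t` is null and parallel, with dual
covector `dr`, and `Rm = -(dr ⊗ dr) ∧ K`, `Ric = (tr J) dr ⊗ dr`, where `K = γ J` and `∧` is the
Kulkarni–Nomizu product. Since `dr` is parallel, `∇ Rm` and `∇ Ric` arise from these by
differentiating `K` (covariantly) and `tr J` along `r`. So each of the three conditions on `g_R`,
read off on the line through the origin, is the corresponding condition on the plane wave. -/

namespace CoordMetric

open Function Matrix
open scoped Matrix.Norms.Operator

section MatrixCalculus

variable {ι : Type*}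

section ContDiff

variable {E : Type*} [Fintype ι] [NormedAddCommGroup E] [NormedSpace ℝ E]

theorem contDiff_matrix_iff {n : WithTop ℕ∞} {M : E → Matrix ι ι ℝ} :
    ContDiff ℝ n M ↔ ∀ i j, ContDiff ℝ n fun x => M x i j := by
  classical
  refine ⟨fun hM i j => (entryLinearMap ℝ ℝ i j).toContinuousLinearMap.contDiff.comp hM,
    fun hM => ?_⟩
  rw [funext fun x => matrix_eq_sum_single (M x)]
  exact ContDiff.sum fun i _ => ContDiff.sum fun j _ =>
    (singleLinearMap (α := ℝ) ℝ i j).toContinuousLinearMap.contDiff.comp (hM i j)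

theorem contDiff_matrix_inv [DecidableEq ι] {n : WithTop ℕ∞} {M : E → Matrix ι ι ℝ}
    (hM : ContDiff ℝ n M) (hunit : ∀ x, IsUnit (M x).det) : ContDiff ℝ n fun x => (M x)⁻¹ := by
  simp only [nonsing_inv_eq_ringInverse]
  refine contDiff_iff_contDiffAt.2 fun x => ?_
  obtain ⟨u, hu⟩ := (isUnit_iff_isUnit_det _).2 (hunit x)
  exact (hu ▸ contDiffAt_ringInverse ℝ u :).comp x hM.contDiffAt

end ContDiff

variable [Finite ι]

theorem hasDerivAt_matrix_apply {M : ℝ → Matrix ι ι ℝ} {M' : Matrix ι ι ℝ} {s : ℝ}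
    (hM : HasDerivAt M M' s) (i j : ι) : HasDerivAt (fun r => M r i j) (M' i j) s := by
  cases nonempty_fintype ι
  exact hasDerivAt_pi.1 (hasDerivAt_pi.1 hM i) j

theorem deriv_matrix_apply {M : ℝ → Matrix ι ι ℝ} {s : ℝ} (hM : DifferentiableAt ℝ M s)
    (i j : ι) : deriv (fun r => M r i j) s = deriv M s i j := by
  cases nonempty_fintype ι
  exact (hasDerivAt_matrix_apply hM.hasDerivAt i j).deriv

theorem isSymm_deriv {M : ℝ → Matrix ι ι ℝ} {s : ℝ} (hM : DifferentiableAt ℝ M s)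
    (hsymm : ∀ r, (M r).IsSymm) : (deriv M s).IsSymm :=
  IsSymm.ext fun i j => by
    simp only [← deriv_matrix_apply hM, (hsymm _).apply i j]

theorem deriv_fromBlocks_const {τ σ : Type*} [Finite τ] [Finite σ] (c : Matrix τ τ ℝ)
    {M : ℝ → Matrix σ σ ℝ} {s : ℝ} (hM : DifferentiableAt ℝ M s)
    (hblock : DifferentiableAt ℝ (fun r => fromBlocks c 0 0 (M r)) s) :
    deriv (fun r => fromBlocks c 0 0 (M r)) s = fromBlocks 0 0 0 (deriv M s) := by
  ext i j
  rw [← deriv_matrix_apply hblock]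
  rcases i with i | i <;> rcases j with j | j <;>
    simp [deriv_matrix_apply hM]

theorem deriv_mulVec_eq_zero {ι : Type*} [Fintype ι] {M : ℝ → Matrix ι ι ℝ} {s : ℝ}
    {v w : ι → ℝ} (hM : DifferentiableAt ℝ M s) (h : ∀ r, M r *ᵥ v = w) : deriv M s *ᵥ v = 0 := by
  ext i
  have hsum : HasDerivAt (fun r => (M r *ᵥ v) i) ((deriv M s *ᵥ v) i) s :=
    HasDerivAt.fun_sum fun j _ => (hasDerivAt_matrix_apply hM.hasDerivAt i j).mul_const (v j)
  simp only [h] at hsum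
  exact hsum.unique (hasDerivAt_const s (w i))

end MatrixCalculus

section MetricFamily

variable {ι E F : Type*} [Fintype ι] [DecidableEq ι] [NormedAddCommGroup E] [NormedSpace ℝ E]
  [NormedAddCommGroup F] [NormedSpace ℝ F]

/-- A smooth family of nondegenerate symmetric bilinear forms on `ℝ^ι`, of any signature: a
semi-Riemannian metric in global coordinates if `E = ι → ℝ`, a curve of inner products if `E = ℝ`.
As in `IsRiemannian`, smoothness is that of the entries. -/
structure IsMetricFamily (M : E → Matrix ι ι ℝ) : Prop where
  smooth : ∀ i j, ContDiff ℝ ∞ fun x => M x i j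
  isSymm : ∀ x, (M x).IsSymm
  isUnit_det : ∀ x, IsUnit (M x).det

theorem IsRiemannian.isMetricFamily {κ : Type} [Fintype κ] [DecidableEq κ]
    {g : (κ → ℝ) → Matrix κ κ ℝ} (hg : IsRiemannian g) : IsMetricFamily g where
  smooth := hg.smooth
  isSymm x := (hg.posDef x).isHermitian
  isUnit_det x := (hg.posDef x).det_pos.ne'.isUnit

namespace IsMetricFamily

variable {M : E → Matrix ι ι ℝ} (hM : IsMetricFamily M)
include hM

theorem contDiff : ContDiff ℝ ∞ M :=
  contDiff_matrix_iff.2 hM.smooth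

theorem contDiff_inv : ContDiff ℝ ∞ fun x => (M x)⁻¹ :=
  contDiff_matrix_inv hM.contDiff hM.isUnit_det

theorem comp {φ : F → E} (hφ : ContDiff ℝ ∞ φ) : IsMetricFamily fun y => M (φ y) where
  smooth i j := (hM.smooth i j).comp hφ
  isSymm y := hM.isSymm (φ y)
  isUnit_det y := hM.isUnit_det (φ y)

end IsMetricFamily

end MetricFamily

section JacobiOperator

variable {ι : Type*} [Fintype ι] [DecidableEq ι]

/-- The shape operator `½ γ⁻¹ γ'` of a curve `γ` of inner products, that is, of the slices
`{r} × ℝ^ι` in the metric `dr² + γ(r)`. -/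
noncomputable def shapeOperator (γ : ℝ → Matrix ι ι ℝ) (s : ℝ) : Matrix ι ι ℝ :=
  (1 / 2 : ℝ) • ((γ s)⁻¹ * deriv γ s)

/-- The Jacobi operator `R(·, ∂_r) ∂_r` of the metric `dr² + γ(r)`, in the form `-(S' + S²)` given
by the Riccati equation of its shape operator `S`. -/
noncomputable def jacobiOperator (γ : ℝ → Matrix ι ι ℝ) (s : ℝ) : Matrix ι ι ℝ :=
  -(deriv (shapeOperator γ) s + shapeOperator γ s * shapeOperator γ s)

/-- The bilinear form `Rm(·, ∂_r, ∂_r, ·)` obtained from the Jacobi operator by lowering its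
index. -/
noncomputable def jacobiForm (γ : ℝ → Matrix ι ι ℝ) (s : ℝ) : Matrix ι ι ℝ :=
  γ s * jacobiOperator γ s

/-- The covariant derivative of the Jacobi form along the `r`-lines of `dr² + γ(r)`, where
`∇_{∂_r} ∂_i = S ∂_i`. -/
noncomputable def covDerivJacobiForm (γ : ℝ → Matrix ι ι ℝ) (s : ℝ) : Matrix ι ι ℝ :=
  deriv (jacobiForm γ) s - (shapeOperator γ s)ᵀ * jacobiForm γ s
    - jacobiForm γ s * shapeOperator γ s

namespace IsMetricFamily

variable {γ : ℝ → Matrix ι ι ℝ} (hγ : IsMetricFamily γ)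
include hγ

theorem contDiff_deriv : ContDiff ℝ ∞ (deriv γ) :=
  (contDiff_infty_iff_deriv.1 hγ.contDiff).2

theorem contDiff_shapeOperator : ContDiff ℝ ∞ (shapeOperator γ) :=
  (hγ.contDiff_inv.mul hγ.contDiff_deriv).const_smul _

theorem contDiff_jacobiOperator : ContDiff ℝ ∞ (jacobiOperator γ) :=
  ((contDiff_infty_iff_deriv.1 hγ.contDiff_shapeOperator).2.add
    (hγ.contDiff_shapeOperator.mul hγ.contDiff_shapeOperator)).neg

theorem contDiff_trace_jacobiOperator : ContDiff ℝ ∞ fun s => (jacobiOperator γ s).trace :=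
  ContDiff.sum fun i _ => contDiff_matrix_iff.1 hγ.contDiff_jacobiOperator i i

theorem contDiff_jacobiForm : ContDiff ℝ ∞ (jacobiForm γ) :=
  hγ.contDiff.mul hγ.contDiff_jacobiOperator

protected theorem isSymm_deriv (s : ℝ) : (deriv γ s).IsSymm :=
  isSymm_deriv (hγ.contDiff.differentiable (by simp) s) hγ.isSymm

theorem mul_shapeOperator (s : ℝ) : γ s * shapeOperator γ s = (1 / 2 : ℝ) • deriv γ s := by
  rw [shapeOperator, Matrix.mul_smul, mul_nonsing_inv_cancel_left _ _ (hγ.isUnit_det s)]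

theorem isSymm_deriv_mul_shapeOperator (s : ℝ) : (deriv γ s * shapeOperator γ s).IsSymm := by
  rw [IsSymm, shapeOperator, Matrix.mul_smul, transpose_smul, transpose_mul, transpose_mul,
    transpose_nonsing_inv, (hγ.isSymm s).eq, (hγ.isSymm_deriv s).eq, Matrix.mul_assoc]

theorem jacobiForm_eq (s : ℝ) :
    jacobiForm γ s
      = (1 / 2 : ℝ) • (deriv γ s * shapeOperator γ s) - (1 / 2 : ℝ) • deriv (deriv γ) s := by
  have hγ' := hγ.contDiff.differentiable (by simp) s
  have hS := hγ.contDiff_shapeOperator.differentiable (by simp) s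
  have hγS : deriv γ s * shapeOperator γ s + γ s * deriv (shapeOperator γ) s
      = (1 / 2 : ℝ) • deriv (deriv γ) s := by
    refine (deriv_fun_mul hγ' hS).symm.trans ?_
    rw [funext hγ.mul_shapeOperator]
    exact deriv_fun_const_smul _ (hγ.contDiff_deriv.differentiable (by simp) s)
  calc jacobiForm γ s
      = -(γ s * deriv (shapeOperator γ) s + γ s * shapeOperator γ s * shapeOperator γ s) := by
        rw [jacobiForm, jacobiOperator, mul_neg, mul_add, Matrix.mul_assoc]
    _ = _ := by
        rw [hγ.mul_shapeOperator, smul_mul_assoc, ← hγS]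
        module

theorem isSymm_jacobiForm (s : ℝ) : (jacobiForm γ s).IsSymm := by
  rw [hγ.jacobiForm_eq]
  exact ((hγ.isSymm_deriv_mul_shapeOperator s).smul _).sub
    ((isSymm_deriv (hγ.contDiff_deriv.differentiable (by simp) s)
      hγ.isSymm_deriv).smul _)

end IsMetricFamily

end JacobiOperator

section Coordinates

variable {κ : Type} [DecidableEq κ]

theorem pd_const (i : κ) (b : ℝ) (x : κ → ℝ) : pd i (fun _ => b) x = 0 := by
  simp [pd]

theorem pd_update [Finite κ] {f : (κ → ℝ) → ℝ} (hf : Differentiable ℝ f) (z : κ) (x : κ → ℝ)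
    (s : ℝ) :
    pd z f (update x z s) = deriv (fun r => f (update x z r)) s := by
  cases nonempty_fintype κ
  exact ((hf _).hasFDerivAt.comp_hasDerivAt s (hasDerivAt_update x z s)).deriv.symm

variable [Fintype κ]

theorem pd_comp_dotProduct {φ : ℝ → ℝ} {φ' : ℝ} (N : κ → ℝ) {x : κ → ℝ}
    (hφ : HasDerivAt φ φ' (N ⬝ᵥ x)) (i : κ) : pd i (fun y => φ (N ⬝ᵥ y)) x = N i * φ' := by
  have hN : HasFDerivAt (fun y => N ⬝ᵥ y) (dotProductBilin ℝ ℝ N).toContinuousLinearMap x :=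
    (dotProductBilin ℝ ℝ N).toContinuousLinearMap.hasFDerivAt
  refine (DFunLike.congr_fun (hφ.comp_hasFDerivAt x hN).fderiv (Pi.single i 1)).trans ?_
  simp [mul_comm]

theorem contDiff_pd {f : (κ → ℝ) → ℝ} (hf : ContDiff ℝ ∞ f) (i : κ) : ContDiff ℝ ∞ (pd i f) :=
  (hf.fderiv_right (by simp)).clm_apply contDiff_const

namespace IsMetricFamily

variable {g : (κ → ℝ) → Matrix κ κ ℝ} (hg : IsMetricFamily g)
include hg

theorem contDiff_christoffel (k i j : κ) : ContDiff ℝ ∞ (christoffel g k i j) :=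
  contDiff_const.mul <| ContDiff.sum fun l _ => (contDiff_matrix_iff.1 hg.contDiff_inv k l).mul
    (((contDiff_pd (hg.smooth j l) i).add (contDiff_pd (hg.smooth i l) j)).sub
      (contDiff_pd (hg.smooth i j) l))

theorem contDiff_curvature (l i j k : κ) : ContDiff ℝ ∞ (curvature g l i j k) :=
  ((contDiff_pd (hg.contDiff_christoffel l j k) i).sub
    (contDiff_pd (hg.contDiff_christoffel l i k) j)).add <| ContDiff.sum fun p _ =>
      ((hg.contDiff_christoffel l i p).mul (hg.contDiff_christoffel p j k)).sub
        ((hg.contDiff_christoffel l j p).mul (hg.contDiff_christoffel p i k))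

theorem contDiff_riemann (i j k l : κ) : ContDiff ℝ ∞ (riemann g i j k l) :=
  ContDiff.sum fun p _ => (hg.smooth p l).mul (hg.contDiff_curvature p i j k)

theorem contDiff_ricci (j k : κ) : ContDiff ℝ ∞ (ricci g j k) :=
  ContDiff.sum fun i _ => hg.contDiff_curvature i i j k

theorem christoffel_comm (k i j : κ) (x : κ → ℝ) :
    christoffel g k i j x = christoffel g k j i x := by
  simp only [christoffel, fun y => (hg.isSymm y).apply j i, add_comm (pd i _ x)]

end IsMetricFamily

end Coordinates

section ConstantRow

variable {κ : Type} [DecidableEq κ]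

/-- The curve of inner products that the metric `g` traces out along the `z`-line through `x`. -/
def restrictLine (g : (κ → ℝ) → Matrix κ κ ℝ) (z : κ) (x : κ → ℝ) (s : ℝ) : Matrix κ κ ℝ :=
  g (update x z s)

variable [Fintype κ] {g : (κ → ℝ) → Matrix κ κ ℝ} {z : κ}

theorem christoffel_apply_self_self_eq_zero (hz : ∀ x y, g x z = g y z) (k : κ) (x : κ → ℝ) :
    christoffel g k z z x = 0 := by
  simp only [christoffel, fun y l => congrFun (hz y 0) l, pd_const]
  simp

namespace IsMetricFamily

variable (hg : IsMetricFamily g) (x : κ → ℝ)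
include hg

protected theorem restrictLine (z : κ) : IsMetricFamily (restrictLine g z x) :=
  hg.comp (contDiff_update ∞ x z)

variable (hz : ∀ x y, g x z = g y z) (s : ℝ)
include hz

theorem christoffel_update (k j : κ) :
    christoffel g k z j (update x z s) = shapeOperator (restrictLine g z x) s k j := by
  have hpd (l : κ) : pd z (fun y => g y j l) (update x z s)
      = deriv (restrictLine g z x) s l j := by
    rw [pd_update ((hg.smooth j l).differentiable (by simp)),
      ← ((hg.restrictLine x z).isSymm_deriv s).apply,
      ← deriv_matrix_apply ((hg.restrictLine x z).contDiff.differentiable (by simp) s)]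
    rfl
  simp only [christoffel, fun y l => congrFun (hz y 0) l, pd_const, hpd, add_zero, sub_zero]
  rfl

theorem curvature_update (k j : κ) :
    curvature g k j z z (update x z s)
      = jacobiOperator (restrictLine g z x) s k j := by
  have hpd : pd z (christoffel g k j z) (update x z s)
      = deriv (shapeOperator (restrictLine g z x)) s k j := by
    rw [pd_update ((hg.contDiff_christoffel k j z).differentiable (by simp)),
      ← deriv_matrix_apply
        ((hg.restrictLine x z).contDiff_shapeOperator.differentiable (by simp) s)]
    simp only [hg.christoffel_comm k j z, hg.christoffel_update x hz]
  have hzz (k : κ) : christoffel g k z z = fun _ => 0 :=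
    funext (christoffel_apply_self_self_eq_zero hz k)
  simp only [curvature, hzz, pd_const, hpd, mul_zero, zero_sub, Finset.sum_neg_distrib]
  simp only [hg.christoffel_comm _ j z, hg.christoffel_update x hz, jacobiOperator,
    Matrix.neg_apply, Matrix.add_apply, mul_apply, neg_add]

theorem riemann_update (i j : κ) :
    riemann g i z z j (update x z s) = jacobiForm (restrictLine g z x) s i j := by
  rw [← ((hg.restrictLine x z).isSymm_jacobiForm s).apply i j]
  simp only [riemann, hg.curvature_update x hz, (hg.isSymm (update x z s)).apply j]
  rfl

theorem ricci_update :
    ricci g z z (update x z s) = (jacobiOperator (restrictLine g z x) s).trace := by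
  simp only [ricci, hg.curvature_update x hz, trace, Matrix.diag_apply]

theorem covDerivRicci_update :
    covDerivRicci g z z z (update x z s)
      = deriv (fun r => (jacobiOperator (restrictLine g z x) r).trace) s := by
  simp only [covDerivRicci, christoffel_apply_self_self_eq_zero hz,
    pd_update ((hg.contDiff_ricci z z).differentiable (by simp)), hg.ricci_update x hz, zero_mul,
    Finset.sum_const_zero, sub_zero]

theorem covDerivRiemann_update (i j : κ) :
    covDerivRiemann g z i z z j (update x z s)
      = covDerivJacobiForm (restrictLine g z x) s i j := by
  have hK := (hg.restrictLine x z).contDiff_jacobiForm.differentiable (by simp) s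
  simp only [covDerivRiemann, christoffel_apply_self_self_eq_zero hz,
    pd_update ((hg.contDiff_riemann i z z j).differentiable (by simp)), hg.riemann_update x hz,
    hg.christoffel_update x hz, deriv_matrix_apply hK, zero_mul, Finset.sum_const_zero, sub_zero,
    covDerivJacobiForm, Matrix.sub_apply, mul_apply, transpose_apply, mul_comm]

end IsMetricFamily

end ConstantRow

section PlaneWave

variable {κ : Type}

/-- The algebraic curvature tensor `-(N ⊗ N) ∧ K`, where `∧` is the Kulkarni–Nomizu product. The
curvature of a plane wave has this shape, with `N` the wave covector. -/
def waveCurvatureForm (N : κ → ℝ) (K : Matrix κ κ ℝ) (i j k l : κ) : ℝ :=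
  N j * N k * K i l - N i * N k * K j l - N j * N l * K i k + N i * N l * K j k

theorem waveCurvatureForm_swap (N : κ → ℝ) (K : Matrix κ κ ℝ) (i j k l : κ) :
    waveCurvatureForm N K i j k l = -waveCurvatureForm N K j i k l := by
  simp only [waveCurvatureForm]
  ring

theorem waveCurvatureForm_pair_swap (N : κ → ℝ) {K : Matrix κ κ ℝ} (hK : K.IsSymm) (i j k l : κ) :
    waveCurvatureForm N K i j k l = waveCurvatureForm N K k l i j := by
  simp only [waveCurvatureForm, hK.apply i l, hK.apply j l, hK.apply i k, hK.apply j k]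
  ring

variable [Fintype κ]

theorem sum_mul_waveCurvatureForm {N X : κ → ℝ} (hX : X ⬝ᵥ N = 0) (K : Matrix κ κ ℝ) (j k l : κ) :
    ∑ p, X p * waveCurvatureForm N K p j k l
      = N j * N k * (X ᵥ* K) l - N j * N l * (X ᵥ* K) k := by
  calc ∑ p, X p * waveCurvatureForm N K p j k l
      = N j * N k * (X ᵥ* K) l - N j * N l * (X ᵥ* K) k
        + (X ⬝ᵥ N) * (N l * K j k - N k * K j l) := by
        simp only [waveCurvatureForm, vecMul, dotProduct, Finset.mul_sum, Finset.sum_mul,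
          ← Finset.sum_sub_distrib, ← Finset.sum_add_distrib]
        exact Finset.sum_congr rfl fun p _ => by ring
    _ = _ := by rw [hX, zero_mul, add_zero]

/-- The metric `x ↦ γ (N ⬝ᵥ x)` on `ℝ^κ`, whose components depend on one linear coordinate only. -/
def waveMetric (γ : ℝ → Matrix κ κ ℝ) (N : κ → ℝ) (x : κ → ℝ) : Matrix κ κ ℝ :=
  γ (N ⬝ᵥ x)

variable [DecidableEq κ]

/-- The data of a plane wave `waveMetric γ N`: the constant vector field `T` is null and metrically
dual to the constant covector `N`, so that the components of the metric are constant along `Tᗮ`. -/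
structure IsPlaneWaveProfile (γ : ℝ → Matrix κ κ ℝ) (N T : κ → ℝ) : Prop
    extends IsMetricFamily γ where
  mulVec_eq : ∀ s, γ s *ᵥ T = N
  dotProduct_eq_zero : N ⬝ᵥ T = 0

namespace IsPlaneWaveProfile

variable {γ : ℝ → Matrix κ κ ℝ} {N T : κ → ℝ} (hγ : IsPlaneWaveProfile γ N T)
include hγ

theorem deriv_mulVec (s : ℝ) : deriv γ s *ᵥ T = 0 :=
  deriv_mulVec_eq_zero (hγ.contDiff.differentiable (by simp) s) hγ.mulVec_eq

theorem inv_mulVec (s : ℝ) : (γ s)⁻¹ *ᵥ N = T := by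
  rw [← hγ.mulVec_eq s, mulVec_mulVec, nonsing_inv_mul _ (hγ.isUnit_det s), one_mulVec]

theorem vecMul_inv (s : ℝ) : N ᵥ* (γ s)⁻¹ = T := by
  rw [← mulVec_transpose, transpose_nonsing_inv, (hγ.isSymm s).eq, hγ.inv_mulVec]

theorem shapeOperator_mulVec (s : ℝ) : shapeOperator γ s *ᵥ T = 0 := by
  rw [shapeOperator, smul_mulVec, ← mulVec_mulVec, hγ.deriv_mulVec, mulVec_zero, smul_zero]

theorem vecMul_shapeOperator (s : ℝ) : N ᵥ* shapeOperator γ s = 0 := by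
  rw [shapeOperator, vecMul_smul, ← vecMul_vecMul, hγ.vecMul_inv, ← mulVec_transpose,
    (hγ.isSymm_deriv s).eq, hγ.deriv_mulVec, smul_zero]

theorem jacobiForm_mulVec (s : ℝ) : jacobiForm γ s *ᵥ T = 0 := by
  have hγ'' : deriv (deriv γ) s *ᵥ T = 0 :=
    deriv_mulVec_eq_zero (hγ.contDiff_deriv.differentiable (by simp) s) hγ.deriv_mulVec
  rw [hγ.jacobiForm_eq, sub_mulVec, smul_mulVec, smul_mulVec, ← mulVec_mulVec,
    hγ.shapeOperator_mulVec, hγ'', mulVec_zero, sub_self]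

theorem vecMul_jacobiForm (s : ℝ) : T ᵥ* jacobiForm γ s = 0 := by
  rw [← mulVec_transpose, (hγ.isSymm_jacobiForm s).eq, hγ.jacobiForm_mulVec]

theorem vecMul_jacobiOperator (s : ℝ) : N ᵥ* jacobiOperator γ s = 0 := by
  have hJ : jacobiOperator γ s = (γ s)⁻¹ * jacobiForm γ s :=
    (nonsing_inv_mul_cancel_left _ _ (hγ.isUnit_det s)).symm
  rw [hJ, ← vecMul_vecMul, hγ.vecMul_inv, hγ.vecMul_jacobiForm]

theorem christoffel_waveMetric (k i j : κ) (x : κ → ℝ) :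
    christoffel (waveMetric γ N) k i j x
      = N i * shapeOperator γ (N ⬝ᵥ x) k j + N j * shapeOperator γ (N ⬝ᵥ x) k i
        - 1 / 2 * T k * deriv γ (N ⬝ᵥ x) i j := by
  have hpd (a b c : κ) : pd a (fun y => γ (N ⬝ᵥ y) b c) x = N a * deriv γ (N ⬝ᵥ x) c b := by
    rw [← (hγ.isSymm_deriv _).apply]
    exact pd_comp_dotProduct N
      (hasDerivAt_matrix_apply (hγ.contDiff.differentiable (by simp) _).hasDerivAt b c) a
  have hT : T k = ∑ l, (γ (N ⬝ᵥ x))⁻¹ k l * N l := (congrFun (hγ.inv_mulVec (N ⬝ᵥ x)) k).symm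
  rw [hT, ← (hγ.isSymm_deriv _).apply i j]
  simp only [christoffel, waveMetric, hpd, shapeOperator, Matrix.smul_apply, mul_apply, smul_eq_mul,
    Finset.mul_sum, Finset.sum_mul, ← Finset.sum_add_distrib, ← Finset.sum_sub_distrib]
  exact Finset.sum_congr rfl fun l _ => by ring

theorem pd_christoffel_waveMetric (a k i j : κ) (x : κ → ℝ) :
    pd a (christoffel (waveMetric γ N) k i j) x
      = N a * (N i * deriv (shapeOperator γ) (N ⬝ᵥ x) k j
        + N j * deriv (shapeOperator γ) (N ⬝ᵥ x) k i
        - 1 / 2 * T k * deriv (deriv γ) (N ⬝ᵥ x) i j) := by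
  have hS := hasDerivAt_matrix_apply
    (hγ.contDiff_shapeOperator.differentiable (by simp) (N ⬝ᵥ x)).hasDerivAt
  have hγ' := hasDerivAt_matrix_apply
    (hγ.contDiff_deriv.differentiable (by simp) (N ⬝ᵥ x)).hasDerivAt
  rw [funext (hγ.christoffel_waveMetric k i j)]
  exact pd_comp_dotProduct N ((((hS k j).const_mul (N i)).add ((hS k i).const_mul (N j))).sub
    ((hγ' i j).const_mul (1 / 2 * T k))) a

theorem dotProduct_christoffel_waveMetric {X : κ → ℝ} (hX : X ⬝ᵥ T = 0) (i j : κ) (x : κ → ℝ) :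
    (X ⬝ᵥ fun p => christoffel (waveMetric γ N) p i j x)
      = N i * (X ᵥ* shapeOperator γ (N ⬝ᵥ x)) j + N j * (X ᵥ* shapeOperator γ (N ⬝ᵥ x)) i := by
  have hΓ : (fun p => christoffel (waveMetric γ N) p i j x)
      = N i • (shapeOperator γ (N ⬝ᵥ x)).col j + N j • (shapeOperator γ (N ⬝ᵥ x)).col i
        - (1 / 2 * deriv γ (N ⬝ᵥ x) i j) • T := by
    ext p
    simp only [hγ.christoffel_waveMetric, Pi.add_apply, Pi.sub_apply, Pi.smul_apply, smul_eq_mul,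
      col_apply]
    ring
  rw [hΓ, dotProduct_sub, dotProduct_add, dotProduct_smul, dotProduct_smul, dotProduct_smul, hX,
    smul_zero, sub_zero]
  rfl

theorem sum_christoffel_mul_christoffel_waveMetric (l i j k : κ) (x : κ → ℝ) :
    ∑ p, christoffel (waveMetric γ N) l i p x * christoffel (waveMetric γ N) p j k x
      = N i * (N j * (shapeOperator γ (N ⬝ᵥ x) * shapeOperator γ (N ⬝ᵥ x)) l k
          + N k * (shapeOperator γ (N ⬝ᵥ x) * shapeOperator γ (N ⬝ᵥ x)) l j)
        - 1 / 2 * T l * (N j * (deriv γ (N ⬝ᵥ x) * shapeOperator γ (N ⬝ᵥ x)) i k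
          + N k * (deriv γ (N ⬝ᵥ x) * shapeOperator γ (N ⬝ᵥ x)) i j) := by
  have hΓ : (fun p => christoffel (waveMetric γ N) l i p x)
      = N i • shapeOperator γ (N ⬝ᵥ x) l + shapeOperator γ (N ⬝ᵥ x) l i • N
        - (1 / 2 * T l) • deriv γ (N ⬝ᵥ x) i := by
    ext p
    simp only [hγ.christoffel_waveMetric, Pi.add_apply, Pi.sub_apply, Pi.smul_apply, smul_eq_mul]
    ring
  have hS : shapeOperator γ (N ⬝ᵥ x) l ⬝ᵥ T = 0 := congrFun (hγ.shapeOperator_mulVec _) l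
  have hγ' : deriv γ (N ⬝ᵥ x) i ⬝ᵥ T = 0 := congrFun (hγ.deriv_mulVec _) i
  have hΓT : (fun p => christoffel (waveMetric γ N) l i p x) ⬝ᵥ T = 0 := by
    rw [hΓ, sub_dotProduct, add_dotProduct, smul_dotProduct, smul_dotProduct, smul_dotProduct, hS,
      hγ', hγ.dotProduct_eq_zero]
    simp only [smul_zero, add_zero, sub_zero]
  refine (hγ.dotProduct_christoffel_waveMetric hΓT j k x).trans ?_
  simp only [hΓ, sub_vecMul, add_vecMul, smul_vecMul, hγ.vecMul_shapeOperator,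
    ← mul_apply_eq_vecMul, Pi.add_apply, Pi.sub_apply, Pi.smul_apply, Pi.zero_apply, smul_eq_mul]
  ring

theorem curvature_waveMetric (l i j k : κ) (x : κ → ℝ) :
    curvature (waveMetric γ N) l i j k x
      = N k * (N j * jacobiOperator γ (N ⬝ᵥ x) l i - N i * jacobiOperator γ (N ⬝ᵥ x) l j)
        + T l * (N i * jacobiForm γ (N ⬝ᵥ x) j k - N j * jacobiForm γ (N ⬝ᵥ x) i k) := by
  have hsymm := (hγ.isSymm_deriv_mul_shapeOperator (N ⬝ᵥ x)).apply i j
  rw [curvature, Finset.sum_sub_distrib]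
  simp only [hγ.pd_christoffel_waveMetric, hγ.sum_christoffel_mul_christoffel_waveMetric,
    hγ.jacobiForm_eq, jacobiOperator, Matrix.add_apply, Matrix.sub_apply, Matrix.neg_apply,
    Matrix.smul_apply, smul_eq_mul, hsymm]
  ring

theorem riemann_waveMetric (i j k l : κ) (x : κ → ℝ) :
    riemann (waveMetric γ N) i j k l x
      = waveCurvatureForm N (jacobiForm γ (N ⬝ᵥ x)) i j k l := by
  have hJ (a : κ) : ∑ p, γ (N ⬝ᵥ x) l p * jacobiOperator γ (N ⬝ᵥ x) p a
      = jacobiForm γ (N ⬝ᵥ x) a l := (hγ.isSymm_jacobiForm _).apply a l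
  have hT : ∑ p, γ (N ⬝ᵥ x) l p * T p = N l := congrFun (hγ.mulVec_eq _) l
  calc riemann (waveMetric γ N) i j k l x
      = ∑ p, (N k * N j * (γ (N ⬝ᵥ x) l p * jacobiOperator γ (N ⬝ᵥ x) p i)
          - N k * N i * (γ (N ⬝ᵥ x) l p * jacobiOperator γ (N ⬝ᵥ x) p j)
          + γ (N ⬝ᵥ x) l p * T p
            * (N i * jacobiForm γ (N ⬝ᵥ x) j k - N j * jacobiForm γ (N ⬝ᵥ x) i k)) := by
        refine Finset.sum_congr rfl fun p _ => ?_
        rw [hγ.curvature_waveMetric, waveMetric, (hγ.isSymm _).apply l p]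
        ring
    _ = waveCurvatureForm N (jacobiForm γ (N ⬝ᵥ x)) i j k l := by
        rw [Finset.sum_add_distrib, Finset.sum_sub_distrib, ← Finset.mul_sum, ← Finset.mul_sum,
          ← Finset.sum_mul, hJ, hJ, hT, waveCurvatureForm]
        ring

theorem ricci_waveMetric (j k : κ) (x : κ → ℝ) :
    ricci (waveMetric γ N) j k x = N j * N k * (jacobiOperator γ (N ⬝ᵥ x)).trace := by
  have hJ : ∑ i, N i * jacobiOperator γ (N ⬝ᵥ x) i j = 0 :=
    congrFun (hγ.vecMul_jacobiOperator _) j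
  have hK : ∑ i, T i * jacobiForm γ (N ⬝ᵥ x) i k = 0 := congrFun (hγ.vecMul_jacobiForm _) k
  have hNT : ∑ i, N i * T i = 0 := hγ.dotProduct_eq_zero
  calc ricci (waveMetric γ N) j k x
      = ∑ i, (N j * N k * jacobiOperator γ (N ⬝ᵥ x) i i
          - N k * (N i * jacobiOperator γ (N ⬝ᵥ x) i j)
          + jacobiForm γ (N ⬝ᵥ x) j k * (N i * T i)
          - N j * (T i * jacobiForm γ (N ⬝ᵥ x) i k)) := by
        refine Finset.sum_congr rfl fun i _ => ?_
        rw [hγ.curvature_waveMetric]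
        ring
    _ = N j * N k * (jacobiOperator γ (N ⬝ᵥ x)).trace := by
        simp only [Finset.sum_sub_distrib, Finset.sum_add_distrib, ← Finset.mul_sum, hJ, hK, hNT,
          mul_zero, sub_zero, add_zero, trace, Matrix.diag_apply]

theorem sum_christoffel_waveMetric_mul (a i : κ) (x : κ → ℝ) :
    ∑ p, christoffel (waveMetric γ N) p a i x * N p = 0 := by
  have hN := hγ.dotProduct_christoffel_waveMetric hγ.dotProduct_eq_zero a i x
  rw [dotProduct_comm, hγ.vecMul_shapeOperator, Pi.zero_apply, Pi.zero_apply, mul_zero, mul_zero,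
    add_zero] at hN
  exact hN

theorem vecMul_christoffel_waveMetric_jacobiForm (a i l : κ) (x : κ → ℝ) :
    ((fun p => christoffel (waveMetric γ N) p a i x) ᵥ* jacobiForm γ (N ⬝ᵥ x)) l
      = N a * (jacobiForm γ (N ⬝ᵥ x) * shapeOperator γ (N ⬝ᵥ x)) l i
        + N i * (jacobiForm γ (N ⬝ᵥ x) * shapeOperator γ (N ⬝ᵥ x)) l a := by
  rw [← (hγ.isSymm_jacobiForm _).eq, vecMul_transpose, (hγ.isSymm_jacobiForm _).eq]
  exact hγ.dotProduct_christoffel_waveMetric (congrFun (hγ.jacobiForm_mulVec _) l) a i x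

theorem sum_christoffel_mul_waveCurvatureForm (a i j k l : κ) (x : κ → ℝ) :
    ∑ p, christoffel (waveMetric γ N) p a i x
        * waveCurvatureForm N (jacobiForm γ (N ⬝ᵥ x)) p j k l
      = N j * N k * (N a * (jacobiForm γ (N ⬝ᵥ x) * shapeOperator γ (N ⬝ᵥ x)) l i
          + N i * (jacobiForm γ (N ⬝ᵥ x) * shapeOperator γ (N ⬝ᵥ x)) l a)
        - N j * N l * (N a * (jacobiForm γ (N ⬝ᵥ x) * shapeOperator γ (N ⬝ᵥ x)) k i
          + N i * (jacobiForm γ (N ⬝ᵥ x) * shapeOperator γ (N ⬝ᵥ x)) k a) := by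
  rw [sum_mul_waveCurvatureForm (hγ.sum_christoffel_waveMetric_mul a i x),
    hγ.vecMul_christoffel_waveMetric_jacobiForm, hγ.vecMul_christoffel_waveMetric_jacobiForm]

theorem covDerivRicci_waveMetric (a i j : κ) (x : κ → ℝ) :
    covDerivRicci (waveMetric γ N) a i j x
      = N a * (N i * N j * deriv (fun s => (jacobiOperator γ s).trace) (N ⬝ᵥ x)) := by
  have hpd : pd a (ricci (waveMetric γ N) i j) x
      = N a * (N i * N j * deriv (fun s => (jacobiOperator γ s).trace) (N ⬝ᵥ x)) := by
    rw [funext (hγ.ricci_waveMetric i j)]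
    exact pd_comp_dotProduct N ((hγ.contDiff_trace_jacobiOperator.differentiable (by simp)
      _).hasDerivAt.const_mul (N i * N j)) a
  rw [covDerivRicci, hpd]
  simp only [hγ.ricci_waveMetric, ← mul_assoc, mul_right_comm _ (N i), ← Finset.sum_mul,
    hγ.sum_christoffel_waveMetric_mul, zero_mul, sub_zero]

theorem covDerivRiemann_waveMetric (a i j k l : κ) (x : κ → ℝ) :
    covDerivRiemann (waveMetric γ N) a i j k l x
      = N a * waveCurvatureForm N (covDerivJacobiForm γ (N ⬝ᵥ x)) i j k l := by
  have hK := hasDerivAt_matrix_apply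
    (hγ.contDiff_jacobiForm.differentiable (by simp) (N ⬝ᵥ x)).hasDerivAt
  have hpd : pd a (riemann (waveMetric γ N) i j k l) x
      = N a * waveCurvatureForm N (deriv (jacobiForm γ) (N ⬝ᵥ x)) i j k l := by
    rw [funext (hγ.riemann_waveMetric i j k l)]
    exact pd_comp_dotProduct N ((((hK i l).const_mul (N j * N k)).sub ((hK j l).const_mul
      (N i * N k))).sub ((hK i k).const_mul (N j * N l)) |>.add ((hK j k).const_mul (N i * N l))) a
  rw [covDerivRiemann, hpd]
  -- The symmetries of the form move every Christoffel correction into the first slot.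
  have hswap₂ (p : κ) := waveCurvatureForm_swap N (jacobiForm γ (N ⬝ᵥ x)) i p k l
  have hswap₃ (p : κ) := waveCurvatureForm_pair_swap N (hγ.isSymm_jacobiForm (N ⬝ᵥ x)) i j p l
  have hswap₄ (p : κ) :=
    (waveCurvatureForm_pair_swap N (hγ.isSymm_jacobiForm (N ⬝ᵥ x)) i j k p).trans
      (waveCurvatureForm_swap N _ k p i j)
  have hSK (b c : κ) : ((shapeOperator γ (N ⬝ᵥ x))ᵀ * jacobiForm γ (N ⬝ᵥ x)) b c
      = (jacobiForm γ (N ⬝ᵥ x) * shapeOperator γ (N ⬝ᵥ x)) c b := by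
    rw [← transpose_apply (jacobiForm γ _ * _), transpose_mul, (hγ.isSymm_jacobiForm _).eq]
  simp only [hγ.riemann_waveMetric, hswap₂, hswap₃, hswap₄, mul_neg, Finset.sum_neg_distrib,
    hγ.sum_christoffel_mul_waveCurvatureForm]
  simp only [waveCurvatureForm, covDerivJacobiForm, Matrix.sub_apply, hSK]
  ring

end IsPlaneWaveProfile
end PlaneWave

section BlockDiagonal

variable {E τ σ : Type*} [Fintype τ] [DecidableEq τ] [Fintype σ] [DecidableEq σ]
  {c : Matrix τ τ ℝ}

theorem isMetricFamily_fromBlocks_iff [NormedAddCommGroup E] [NormedSpace ℝ E]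
    {β : E → Matrix σ σ ℝ} :
    IsMetricFamily (fun s => fromBlocks c 0 0 (β s))
      ↔ (c.IsSymm ∧ IsUnit c.det) ∧ IsMetricFamily β := by
  refine ⟨fun h => ?_, fun ⟨hc, hβ⟩ => ?_⟩
  · have hsymm s := isSymm_fromBlocks_iff.1 (h.isSymm s)
    have hdet s : IsUnit (c.det * (β s).det) := det_fromBlocks_zero₂₁ c 0 (β s) ▸ h.isUnit_det s
    exact ⟨⟨(hsymm 0).1, isUnit_of_mul_isUnit_left (hdet 0)⟩,
      fun i j => h.smooth (.inr i) (.inr j), fun s => (hsymm s).2.2.2,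
      fun s => isUnit_of_mul_isUnit_right (hdet s)⟩
  · refine ⟨?_, fun s => hc.1.fromBlocks rfl (hβ.isSymm s), fun s => ?_⟩
    · rintro (i | i) (j | j)
      exacts [contDiff_const, contDiff_const, contDiff_const, hβ.smooth i j]
    · exact det_fromBlocks_zero₂₁ c 0 (β s) ▸ hc.2.mul (hβ.isUnit_det s)

variable {β : ℝ → Matrix σ σ ℝ} (hβ : IsMetricFamily fun s => fromBlocks c 0 0 (β s))
include hβ

theorem shapeOperator_fromBlocks :
    shapeOperator (fun s => fromBlocks c 0 0 (β s))
      = fun s => fromBlocks 0 0 0 (shapeOperator β s) := by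
  obtain ⟨⟨-, hc⟩, hβ'⟩ := isMetricFamily_fromBlocks_iff.1 hβ
  ext1 s
  have hinv : (fromBlocks c 0 0 (β s))⁻¹ = fromBlocks c⁻¹ 0 0 (β s)⁻¹ :=
    inv_eq_right_inv <| by
      simp [fromBlocks_multiply, mul_nonsing_inv _ hc, mul_nonsing_inv _ (hβ'.isUnit_det s)]
  rw [shapeOperator, hinv, deriv_fromBlocks_const c (hβ'.contDiff.differentiable (by simp) s)
    (hβ.contDiff.differentiable (by simp) s), fromBlocks_multiply, fromBlocks_smul]
  simp [shapeOperator]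

theorem jacobiOperator_fromBlocks :
    jacobiOperator (fun s => fromBlocks c 0 0 (β s))
      = fun s => fromBlocks 0 0 0 (jacobiOperator β s) := by
  have hβ' := (isMetricFamily_fromBlocks_iff.1 hβ).2
  have hS := hβ.contDiff_shapeOperator
  rw [shapeOperator_fromBlocks hβ] at hS
  ext1 s
  rw [jacobiOperator, shapeOperator_fromBlocks hβ,
    deriv_fromBlocks_const 0 (hβ'.contDiff_shapeOperator.differentiable (by simp) s)
      (hS.differentiable (by simp) s), fromBlocks_multiply, fromBlocks_add, fromBlocks_neg]
  simp [jacobiOperator]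

theorem trace_jacobiOperator_fromBlocks (s : ℝ) :
    (jacobiOperator (fun s => fromBlocks c 0 0 (β s)) s).trace = (jacobiOperator β s).trace := by
  simp [jacobiOperator_fromBlocks hβ, trace]

theorem jacobiForm_fromBlocks :
    jacobiForm (fun s => fromBlocks c 0 0 (β s))
      = fun s => fromBlocks 0 0 0 (jacobiForm β s) := by
  ext1 s
  rw [jacobiForm, jacobiOperator_fromBlocks hβ, fromBlocks_multiply]
  simp [jacobiForm]

theorem covDerivJacobiForm_fromBlocks (s : ℝ) :
    covDerivJacobiForm (fun s => fromBlocks c 0 0 (β s)) s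
      = fromBlocks 0 0 0 (covDerivJacobiForm β s) := by
  have hβ' := (isMetricFamily_fromBlocks_iff.1 hβ).2
  have hK := hβ.contDiff_jacobiForm
  rw [jacobiForm_fromBlocks hβ] at hK
  rw [covDerivJacobiForm, jacobiForm_fromBlocks hβ, shapeOperator_fromBlocks hβ,
    deriv_fromBlocks_const 0 (hβ'.contDiff_jacobiForm.differentiable (by simp) s)
      (hK.differentiable (by simp) s), fromBlocks_transpose, fromBlocks_multiply,
    fromBlocks_multiply]
  ext (i | i) (j | j) <;> simp [covDerivJacobiForm]

end BlockDiagonal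

section PlaneWaveExtension

variable {m : ℕ} {gbar : ℝ → Matrix (Fin m) (Fin m) ℝ}

theorem planeWave_eq_waveMetric (gbar : ℝ → Matrix (Fin m) (Fin m) ℝ) :
    planeWave gbar = waveMetric (fun s => fromBlocks !![0, 1; 1, 0] 0 0 (gbar s))
      (Pi.single (.inl 0) 1) := by
  ext1 x
  rw [waveMetric, single_dotProduct, one_mul, planeWave]

theorem IsMetricFamily.isPlaneWaveProfile (hgbar : IsMetricFamily gbar) :
    IsPlaneWaveProfile (fun s => fromBlocks !![(0 : ℝ), 1; 1, 0] 0 0 (gbar s))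
      (Pi.single (.inl 0) 1) (Pi.single (.inl 1) 1) where
  toIsMetricFamily := isMetricFamily_fromBlocks_iff.2
    ⟨⟨IsSymm.ext fun i j => by fin_cases i <;> fin_cases j <;> rfl, by simp [det_fin_two]⟩, hgbar⟩
  mulVec_eq s := by
    rw [mulVec_single_one]
    ext (i | i)
    · fin_cases i <;> simp
    · simp
  dotProduct_eq_zero := by simp

theorem ricciFlat_planeWave (hgbar : IsMetricFamily gbar)
    (htrace : ∀ s, (jacobiOperator gbar s).trace = 0) : RicciFlat (planeWave gbar) := by
  intro x i j
  rw [planeWave_eq_waveMetric, hgbar.isPlaneWaveProfile.ricci_waveMetric,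
    trace_jacobiOperator_fromBlocks hgbar.isPlaneWaveProfile.toIsMetricFamily, htrace, mul_zero]

theorem parallelRicci_planeWave (hgbar : IsMetricFamily gbar)
    (htrace : ∀ s, deriv (fun r => (jacobiOperator gbar r).trace) s = 0) :
    ParallelRicci (planeWave gbar) := by
  intro x a i j
  rw [planeWave_eq_waveMetric, hgbar.isPlaneWaveProfile.covDerivRicci_waveMetric]
  simp only [trace_jacobiOperator_fromBlocks hgbar.isPlaneWaveProfile.toIsMetricFamily, htrace,
    mul_zero]

theorem locallySymmetric_planeWave (hgbar : IsMetricFamily gbar)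
    (hK : ∀ s, covDerivJacobiForm gbar s = 0) : LocallySymmetric (planeWave gbar) := by
  intro x a i j k l
  rw [planeWave_eq_waveMetric, hgbar.isPlaneWaveProfile.covDerivRiemann_waveMetric,
    covDerivJacobiForm_fromBlocks hgbar.isPlaneWaveProfile.toIsMetricFamily, hK, fromBlocks_zero]
  simp [waveCurvatureForm]

end PlaneWaveExtension

section RiemannianExtension

variable {m : ℕ} {gbar : ℝ → Matrix (Fin m) (Fin m) ℝ}
  {gR : (Fin 1 ⊕ Fin m → ℝ) → Matrix (Fin 1 ⊕ Fin m) (Fin 1 ⊕ Fin m) ℝ}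

theorem riemannianExtensions_row_const (hgR : gR ∈ riemannianExtensions gbar)
    (x y : Fin 1 ⊕ Fin m → ℝ) : gR x (.inl 0) = gR y (.inl 0) := by
  obtain ⟨-, g, hblock, -⟩ := hgR
  rw [hblock, hblock]
  ext (j | j) <;> rfl

theorem riemannianExtensions_update (hgR : gR ∈ riemannianExtensions gbar) (s : ℝ) :
    gR (update 0 (.inl 0) s) = fromBlocks 1 0 0 (gbar s) := by
  obtain ⟨-, g, hblock, hline⟩ := hgR
  have hs : update (0 : Fin 1 ⊕ Fin m → ℝ) (.inl 0) s = Sum.elim (fun _ => s) fun _ => 0 := by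
    ext (i | i)
    · rw [Subsingleton.elim i 0]
      simp
    · simp
  rw [hblock, hs, hline]

end RiemannianExtension

end CoordMetric

open CoordMetric Function Matrix in
theorem mainTheorem5_general {τ : Type} [Fintype τ] [DecidableEq τ] {m : ℕ}
    {g : (τ ⊕ Fin m → ℝ) → Matrix (τ ⊕ Fin m) (τ ⊕ Fin m) ℝ} {c : Matrix τ τ ℝ}
    {gbar : ℝ → Matrix (Fin m) (Fin m) ℝ} {z : τ} {x : τ ⊕ Fin m → ℝ}
    (hg : IsMetricFamily g) (hz : ∀ y y', g y (.inl z) = g y' (.inl z))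
    (hline : ∀ s, g (update x (.inl z) s) = fromBlocks c 0 0 (gbar s)) :
    (RicciFlat g → RicciFlat (planeWave gbar)) ∧
    (LocallySymmetric g → LocallySymmetric (planeWave gbar)) ∧
    (ParallelRicci g → ParallelRicci (planeWave gbar)) := by
  have hγ := hg.restrictLine x (.inl z)
  have hrestrict : restrictLine g (.inl z) x = fun s => fromBlocks c 0 0 (gbar s) := funext hline
  rw [hrestrict] at hγ
  have hgbar := (isMetricFamily_fromBlocks_iff.1 hγ).2
  refine ⟨fun hflat => ricciFlat_planeWave hgbar fun s => ?_,
    fun hsymm => locallySymmetric_planeWave hgbar fun s => ?_,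
    fun hparallel => parallelRicci_planeWave hgbar fun s => ?_⟩
  · rw [← trace_jacobiOperator_fromBlocks hγ, ← hrestrict, ← hg.ricci_update x hz]
    exact hflat _ _ _
  · ext i j
    have hK := hsymm (update x (.inl z) s) (.inl z) (.inr i) (.inl z) (.inl z) (.inr j)
    rwa [hg.covDerivRiemann_update x hz, hrestrict,
      covDerivJacobiForm_fromBlocks hγ] at hK
  · simp only [← trace_jacobiOperator_fromBlocks hγ, ← hrestrict]
    rw [← hg.covDerivRicci_update x hz]
    exact hparallel _ _ _ _

theorem mainTheorem5 (m : ℕ) (gbar : ℝ → Matrix (Fin m) (Fin m) ℝ)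
    (hsmooth : ∀ i j, ContDiff ℝ ∞ (fun r => gbar r i j))
    (hpos : ∀ r, (gbar r).PosDef) :
    (¬ CoordMetric.RicciFlat (planeWave gbar) →
      ∀ gR ∈ riemannianExtensions gbar, ¬ CoordMetric.RicciFlat gR) ∧
    (¬ CoordMetric.LocallySymmetric (planeWave gbar) →
      ∀ gR ∈ riemannianExtensions gbar, ¬ CoordMetric.LocallySymmetric gR) ∧
    (¬ CoordMetric.ParallelRicci (planeWave gbar) →
      ∀ gR ∈ riemannianExtensions gbar, ¬ CoordMetric.ParallelRicci gR) := by
  have key {gR} (hgR : gR ∈ riemannianExtensions gbar) :=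
    mainTheorem5_general hgR.1.isMetricFamily (CoordMetric.riemannianExtensions_row_const hgR)
      (CoordMetric.riemannianExtensions_update hgR)
  exact ⟨fun h _ hgR => mt (key hgR).1 h, fun h _ hgR => mt (key hgR).2.1 h,
    fun h _ hgR => mt (key hgR).2.2 h⟩
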